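/- Let $K$ be a field, $S=K[x_1,\dots,x_n]$, and let $J\subset S$ be a monomial ideal of codimension (height) $2$ with a linear resolution such that $S/J$ is Cohen-Macaulay. Let $u_1,\dots,u_m$ be the minimal monomial generators of $J$. A relation matrix of $J$ is an $(m-1)\times m$-matrix over $S$ whose rows generate the module of relations $\{(c_1,\dots,c_m)\in S^m : \sum_i c_iu_i=0\}$ and are all of binomial type, that is, each row expresses a relation $x_ku_i-x_lu_j=0$ with $i\ne j$ (entry $x_k$ in column $i$, entry $-x_l$ in column $j$, zeros elsewhere). The relation graph of such a matrix is the graph on $\{1,\dots,m\}$ in which $i\neq j$ are adjacent if and only if some row is non-zero in both columns $i$ and $j$. For a tree $T$ on $\{1,\dots,m\}$, let $A_T$ be the matrix over the polynomial ring $K[x_{ij},x_{ji} : \{i,j\}\in E(T)]$ (in $2(m-1)$ variables) with rows indexed by the edges of $T$, where the row of the edge $\{i,j\}$, $i<j$, has entry $x_{ij}$ in column $i$, entry $-x_{ji}$ in column $j$, and zeros elsewhere. Let $J_T$ be the ideal of maximal minors of $A_T$. Proposition. Suppose that $A$ is a relation matrix of $J$ such that the variables appearing in $A$ (in its $2(m-1)$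 non-zero entries) are pairwise distinct. Then the relation graph $T$ of $A$ is a tree; $J$ is isomorphic to $J_T$, in the sense that there is a bijection from the variables of $J_T$ to the variables of $S$ that divide some $u_i$ such that the corresponding renaming of variables takes $J_T$ to an ideal generating $J$ in $S$; and $T$ is the unique relation tree of $J$, i.e. every relation matrix of $J$ with respect to $u_1,\dots,u_m$ has relation graph $T$. -/

import Mathlib

open MvPolynomial

/-- A Noetherian local ring `R` is Cohen-Macaulay if its maximal ideal contains an `R`-regular
sequence whose length is the Krull dimension of `R`. -/
def IsCohenMacaulayLocalRing (R : Type*) [CommRing R] [IsLocalRing R] : Prop :=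
  ∃ rs : List R, (∀ r ∈ rs, r ∈ IsLocalRing.maximalIdeal R) ∧
    RingTheory.Sequence.IsRegular R rs ∧ (rs.length : WithBot ℕ∞) = ringKrullDim R

/-- A Noetherian ring is Cohen-Macaulay if all its localizations at prime ideals are. -/
def IsCohenMacaulayRing (R : Type*) [CommRing R] : Prop :=
  ∀ (p : Ideal R) [p.IsPrime], IsCohenMacaulayLocalRing (Localization.AtPrime p)

/-- The ideal `J` of the polynomial ring `S` has a linear resolution: for some `d` it has a graded
free resolution `⋯ → S(-d-2)^(b 2) → S(-d-1)^(b 1) → S(-d)^(b 0) → J → 0`. The first map sends the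
basis to forms of degree `d`, and the matrices `M i` of the other maps (acting on row vectors)
consist of linear forms, so that the resolution is minimal. -/
def HasLinearResolution {K : Type*} [Field K] {n : ℕ} (J : Ideal (MvPolynomial (Fin n) K)) :
    Prop :=
  ∃ (d : ℕ) (b : ℕ → ℕ) (g : Fin (b 0) → MvPolynomial (Fin n) K)
    (M : (i : ℕ) → Matrix (Fin (b (i + 1))) (Fin (b i)) (MvPolynomial (Fin n) K)),
    (∀ k, (g k).IsHomogeneous d) ∧ Ideal.span (Set.range g) = J ∧
    (∀ i k l, (M i k l).IsHomogeneous 1) ∧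
    Function.Exact (M 0).vecMulLinear (Fintype.linearCombination (MvPolynomial (Fin n) K) g) ∧
    ∀ i, Function.Exact (M (i + 1)).vecMulLinear (M i).vecMulLinear

/-- The monomials with exponent vectors `u 1, …, u m` are the minimal monomial generators of `J`
(listed without repetition): they generate `J` and none of them divides another one. In particular
`J` is a monomial ideal. -/
structure IsMinimalMonomialGenerators {K : Type*} [Field K] {n m : ℕ}
    (J : Ideal (MvPolynomial (Fin n) K)) (u : Fin m → (Fin n →₀ ℕ)) : Prop where
  span_eq : Ideal.span (Set.range fun i => monomial (u i) (1 : K)) = J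
  not_le : ∀ i j, i ≠ j → ¬ u i ≤ u j

/-- `A` is a relation matrix (with rows of binomial type) of the ideal minimally generated by the
monomials with exponent vectors `u 1, …, u m`: each of its `m - 1` rows is a relation of the form
`x_k u_i - x_l u_j = 0` with `i ≠ j`, and the rows generate the module of all relations
`(c_1, …, c_m)`, `∑ c_i u_i = 0`. -/
structure IsRelationMatrix {K : Type*} [Field K] {n m : ℕ} (u : Fin m → (Fin n →₀ ℕ))
    (A : Matrix (Fin (m - 1)) (Fin m) (MvPolynomial (Fin n) K)) : Prop where
  binomial : ∀ r, ∃ (i j : Fin m) (k l : Fin n), i ≠ j ∧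
    A r = Pi.single i (X k) - Pi.single j (X l)
  exact : Function.Exact A.vecMulLinear
    (Fintype.linearCombination (MvPolynomial (Fin n) K) fun i => monomial (u i) (1 : K))

/-- The variables appearing in the matrix `A` are pairwise distinct: entries of `A` at two different
positions have no variable in common. -/
def HasDistinctVariables {K : Type*} [Field K] {n : ℕ} {ρ ι : Type*}
    (A : Matrix ρ ι (MvPolynomial (Fin n) K)) : Prop :=
  ∀ r c r' c', (r, c) ≠ (r', c') → Disjoint (A r c).vars (A r' c').vars

/-- The relation graph (relation tree) of `A`: its vertices are the column indices, and two distinct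
columns are adjacent if and only if some row of `A` is non-zero in both of them. -/
def relationGraph {R : Type*} [Zero R] {ρ ι : Type*} (A : Matrix ρ ι R) : SimpleGraph ι where
  Adj i j := i ≠ j ∧ ∃ r, A r i ≠ 0 ∧ A r j ≠ 0
  symm := ⟨fun _ _ ⟨hij, r, hi, hj⟩ => ⟨hij.symm, r, hj, hi⟩⟩
  loopless := ⟨fun _ h => h.1 rfl⟩

open Classical in
/-- The generic matrix `A_T` of a graph `T` on `{1, …, m}`, over the polynomial ring in the variables
`x_{ij}`, `(i, j)` an ordered pair of adjacent vertices. The rows are indexed by the edges of `T`;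
the row of the edge `{i, j}` with `i < j` has the entry `x_{ij}` in column `i`, the entry `-x_{ji}`
in column `j`, and is zero elsewhere. (The sum over `j` below has at most one non-zero term: the one
where `j` is the other end of the edge `e` containing `l`.) -/
noncomputable def genericMatrix (K : Type*) [Field K] {m : ℕ} (T : SimpleGraph (Fin m)) :
    Matrix T.edgeSet (Fin m) (MvPolynomial T.Dart K) := fun e l =>
  ∑ j, if h : e.1 = s(l, j) then
    have hadj : T.Adj l j := by
      rw [← SimpleGraph.mem_edgeSet, ← h]
      exact e.2
    if l < j then X ⟨(l, j), hadj⟩ else -X ⟨(l, j), hadj⟩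
  else 0

open Classical in
/-- The ideal of maximal minors of a matrix with at most as many rows as columns. -/
noncomputable def maximalMinorsIdeal {R : Type*} [CommRing R] {ρ ι : Type*} [Fintype ρ]
    (A : Matrix ρ ι R) : Ideal R :=
  Ideal.span (Set.range fun f : ρ ↪ ι => (A.submatrix id f).det)

open Classical in
/-- The ideal `J_T` of maximal minors of the generic matrix of `T`. -/
noncomputable def genericIdeal (K : Type*) [Field K] {m : ℕ} (T : SimpleGraph (Fin m)) :
    Ideal (MvPolynomial T.Dart K) :=
  maximalMinorsIdeal (genericMatrix K T)

/-- The ideal `J`, with minimal monomial generators `u`, is isomorphic to the ideal `I` of the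
polynomial ring in the variables `τ`: a bijective renaming of the variables in `τ` to the variables
appearing in the generators of `J` takes `I` to (generators of) `J`. -/
def IsIsomorphicByRenaming {K : Type*} [Field K] {n m : ℕ} {τ : Type*}
    (J : Ideal (MvPolynomial (Fin n) K)) (u : Fin m → (Fin n →₀ ℕ))
    (I : Ideal (MvPolynomial τ K)) : Prop :=
  ∃ φ : τ ≃ {v : Fin n // ∃ i, u i v ≠ 0},
    I.map (rename (R := K) fun t => (φ t : Fin n)) = J

/-!
Write `T` for the relation graph of `A`. For `i ≠ j` there is the relation `u_j e_i - u_i e_j`;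
if `i` and `j` lay in different components of `T`, its part in the component of `i` would be a
relation as well, which is absurd. So `T` is connected (`IsRelationMatrix.connected`), and having at
most one edge for each of the `m - 1` rows, it is a tree (`IsRelationMatrix.isTree`).

Each edge `{a, b}` carries two variables `x_{ab}`, `x_{ba}` with `x_{ab} u_a = x_{ba} u_b`, and all
these labels are distinct. As `J` has height `2`, no variable divides all the `u_a`
(`exists_apply_eq_zero_of_one_lt_height`). Across the edges of `T`, the exponent of `x_{ab}` changes
only on the edge `{a, b}`, where it grows by one from `a` to `b`; since it is zero somewhere, it is
determined on the whole tree. Rooting `T` at `r`, with `p a` the parent of `a`, this says that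
`u_r = ∏_{a ≠ r} x_{a, p a}` (`IsRelationLabelling.eq_sum`). The maximal minor of the generic matrix
without column `r` is the same product up to sign, because the matrix is triangular with respect to
the distance to the root (`IsParentMap.minor_associated`). This gives the isomorphism of `J` and
`J_T`; the Hilbert-Burch theorem is not needed.

Finally, a row of any relation matrix is a relation `x_k u_i = x_l u_j`, so that `u_i` and `u_j`
differ in at most two variables, whereas vertices at distance at least two in `T` differ in at least
three. Hence the relation graph of any other relation matrix is a connected subgraph of `T`
(`IsRelationLabelling.adj_of_add_single_eq`), and equals `T` because trees are minimal connected.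
-/

/-! ### Rooted trees -/

/-- A choice of a parent `p a` for each vertex `a ≠ r` of the graph `T`: a neighbour of `a` of
smaller level, where `d` is the level function. The value `p r` is irrelevant. -/
structure IsParentMap {V : Type*} (T : SimpleGraph V) (r : V) (p : V → V) (d : V → ℕ) : Prop where
  adj : ∀ a, a ≠ r → T.Adj a (p a)
  lt : ∀ a, a ≠ r → d (p a) < d a

theorem SimpleGraph.Connected.exists_isParentMap {V : Type*} {T : SimpleGraph V}
    (hT : T.Connected) (r : V) : ∃ p d, IsParentMap T r p d := by
  have h : ∀ a, ∃ b, a ≠ r → T.Adj a b ∧ T.dist b r < T.dist a r := by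
    intro a
    by_cases ha : a = r
    · exact ⟨a, fun h => absurd ha h⟩
    · obtain ⟨w, hw⟩ := hT.exists_walk_length_eq_dist a r
      cases w with
      | nil => exact absurd rfl ha
      | @cons _ b _ hab q =>
        refine ⟨b, fun _ => ⟨hab, ?_⟩⟩
        have := SimpleGraph.dist_le q
        simp only [SimpleGraph.Walk.length_cons] at hw
        omega
  choose p hp using h
  exact ⟨p, fun a => T.dist a r, fun a ha => (hp a ha).1, fun a ha => (hp a ha).2⟩

namespace IsParentMap

variable {V : Type*} {T : SimpleGraph V} {r : V} {p : V → V} {d : V → ℕ}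

theorem induct (h : IsParentMap T r p d) {P : V → Prop} (root : P r)
    (step : ∀ a, a ≠ r → P (p a) → P a) (a : V) : P a := by
  induction hn : d a using Nat.strong_induction_on generalizing a with
  | _ n ih =>
    by_cases ha : a = r
    · exact ha ▸ root
    · exact step a ha (ih _ (hn ▸ h.lt a ha) _ rfl)

theorem ne_of_eq (h : IsParentMap T r p d) {a b : V} (ha : a ≠ r) (hb : b ≠ r)
    (hab : p a = b) : p b ≠ a := by
  intro hba
  have h1 := h.lt _ ha
  have h2 := h.lt _ hb
  rw [hab] at h1
  rw [hba] at h2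
  omega

/-- The edge from a vertex other than the root to its parent. -/
def edge (h : IsParentMap T r p d) (a : {a // a ≠ r}) : T.edgeSet :=
  ⟨s(a.1, p a.1), h.adj a.1 a.2⟩

theorem edge_injective (h : IsParentMap T r p d) : Function.Injective h.edge := by
  intro a b hab
  have h1 : s(a.1, p a.1) = s(b.1, p b.1) := congrArg Subtype.val hab
  rcases Sym2.eq_iff.1 h1 with h2 | h2
  · exact Subtype.ext h2.1
  · exact absurd h2.1.symm (h.ne_of_eq a.2 b.2 h2.2)

theorem edge_bijective [Finite V] (h : IsParentMap T r p d) (hT : T.IsTree) :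
    Function.Bijective h.edge := by
  classical
  have := Fintype.ofFinite V
  rw [Fintype.bijective_iff_injective_and_card]
  refine ⟨h.edge_injective, ?_⟩
  have h1 := hT.card_edgeFinset
  rw [SimpleGraph.edgeFinset_card] at h1
  have h2 : Fintype.card {a // a ≠ r} = Fintype.card V - 1 := by
    simp [Fintype.card_subtype_compl]
  omega

end IsParentMap

/-! ### Exponents along a labelled tree -/

/-- A labelling of a graph `T` adapted to exponent vectors `u a` attached to its vertices: an edge
`{a, b}` carries the label `x a b` at `a` and the label `x b a` at `b`, such that the monomials
satisfy `x_{ab} u_a = x_{ba} u_b`; different pairs (edge, end) have different labels; and no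
variable divides all the monomials. The values `x a b` for non-adjacent `a, b` are irrelevant. -/
structure IsRelationLabelling {V σ : Type*} (T : SimpleGraph V) (u : V → σ →₀ ℕ)
    (x : V → V → σ) : Prop where
  rel : ∀ a b, T.Adj a b → u a + Finsupp.single (x a b) 1 = u b + Finsupp.single (x b a) 1
  inj : ∀ a b a' b', T.Adj a b → T.Adj a' b' → x a b = x a' b' → a = a' ∧ b = b'
  exists_eq_zero : ∀ y, ∃ a, u a y = 0

namespace IsRelationLabelling

variable {V σ : Type*} {T : SimpleGraph V} {u : V → σ →₀ ℕ} {x : V → V → σ}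
  {r : V} {p : V → V} {d : V → ℕ}

theorem rel_apply (h : IsRelationLabelling T u x) {a b : V} (hab : T.Adj a b) (y : σ)
    [Decidable (x a b = y)] [Decidable (x b a = y)] :
    u a y + (if x a b = y then 1 else 0) = u b y + (if x b a = y then 1 else 0) := by
  have := DFunLike.congr_fun (h.rel a b hab) y
  simpa only [Finsupp.add_apply, Finsupp.single_apply] using this

theorem label_ne (h : IsRelationLabelling T u x) {a b : V} (hab : T.Adj a b) :
    x b a ≠ x a b := fun e => hab.ne (h.inj b a a b hab.symm hab e).2

theorem apply_label (h : IsRelationLabelling T u x) {a b : V} (hab : T.Adj a b) :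
    u b (x a b) = u a (x a b) + 1 := by
  classical
  simpa [h.label_ne hab] using (h.rel_apply hab (x a b)).symm

theorem apply_eq (h : IsRelationLabelling T u x) {a b : V} (hab : T.Adj a b) {y : σ}
    (h1 : x a b ≠ y) (h2 : x b a ≠ y) : u a y = u b y := by
  classical
  simpa [h1, h2] using h.rel_apply hab y

theorem apply_eq_zero (h : IsRelationLabelling T u x) (hp : IsParentMap T r p d) {y : σ}
    (hy : ∀ a, a ≠ r → x a (p a) ≠ y) : u r y = 0 := by
  classical
  have key : ∀ a, u r y ≤ u a y := by
    refine hp.induct le_rfl fun a ha ih => ?_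
    have := h.rel_apply (hp.adj a ha) y
    rw [if_neg (hy a ha)] at this
    omega
  obtain ⟨b, hb⟩ := h.exists_eq_zero y
  exact Nat.le_zero.1 (hb ▸ key b)

theorem apply_label_parent (h : IsRelationLabelling T u x) (hp : IsParentMap T r p d) {a : V}
    (ha : a ≠ r) : u r (x a (p a)) = 1 := by
  classical
  set y := x a (p a) with hy
  have hedge := h.apply_label (hp.adj a ha)
  rw [← hy] at hedge
  clear_value y
  have hpar : ∀ b, b ≠ r → b ≠ a → x b (p b) ≠ y := fun b hb hba e =>
    hba (h.inj _ _ _ _ (hp.adj b hb) (hp.adj a ha) (e.trans hy)).1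
  have hrev : ∀ b, b ≠ r → x (p b) b ≠ y := fun b hb e => by
    have := h.inj _ _ _ _ (hp.adj b hb).symm (hp.adj a ha) (e.trans hy)
    exact hp.ne_of_eq hb ha this.1 this.2.symm
  -- Off the edge from `a` to `p a` the exponent of `y` is constant, so the exponent takes at most
  -- the two values `u r y` and `u r y - 1`, and it takes the value `0`.
  have hle : ∀ b, u b y ≤ u r y := by
    refine hp.induct le_rfl fun b hb ih => ?_
    have := h.rel_apply (hp.adj b hb) y
    rw [if_neg (hrev b hb)] at this
    omega
  have hge : ∀ b, u r y ≤ u b y + 1 ∧ (d b < d a → u r y ≤ u b y) := by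
    intro b
    induction hn : d b using Nat.strong_induction_on generalizing b with
    | _ n ih =>
      by_cases hb : b = r
      · subst hb; omega
      obtain ⟨h1, h2⟩ := ih _ (hn ▸ hp.lt b hb) (p b) rfl
      have hlt := hp.lt b hb
      by_cases hba : b = a
      · subst hba
        have h3 := h2 hlt
        omega
      · have := h.rel_apply (hp.adj b hb) y
        rw [if_neg (hrev b hb), if_neg (hpar b hb hba)] at this
        exact ⟨by omega, fun h3 => by have := h2 (by omega); omega⟩
  obtain ⟨b, hb⟩ := h.exists_eq_zero y
  have h1 := (hge b).1
  have h2 := hle (p a)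
  omega

/-- The exponent vector at the root is the product of the labels pointing towards the root. -/
theorem eq_sum (h : IsRelationLabelling T u x) (hp : IsParentMap T r p d)
    [Fintype {a // a ≠ r}] :
    u r = ∑ a : {a // a ≠ r}, Finsupp.single (x a.1 (p a.1)) 1 := by
  classical
  ext y
  rw [Finsupp.finsetSum_apply]
  by_cases hy : ∃ a, a ≠ r ∧ x a (p a) = y
  · obtain ⟨a, ha, rfl⟩ := hy
    rw [h.apply_label_parent hp ha, Finset.sum_eq_single ⟨a, ha⟩]
    · simp
    · intro b _ hb
      refine Finsupp.single_eq_of_ne fun e => hb (Subtype.ext ?_)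
      exact (h.inj _ _ _ _ (hp.adj b.1 b.2) (hp.adj a ha) e.symm).1
    · simp
  · push Not at hy
    rw [h.apply_eq_zero hp hy, Finset.sum_eq_zero]
    exact fun a _ => Finsupp.single_eq_of_ne (hy a.1 a.2).symm

theorem apply_le_one (h : IsRelationLabelling T u x) (hT : T.Connected) (a : V) (y : σ) :
    u a y ≤ 1 := by
  obtain ⟨p, d, hp⟩ := hT.exists_isParentMap a
  by_cases hy : ∃ b, b ≠ a ∧ x b (p b) = y
  · obtain ⟨b, hb, rfl⟩ := hy
    exact (h.apply_label_parent hp hb).le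
  · push Not at hy
    simp [h.apply_eq_zero hp hy]

/-- The labels are exactly the variables which divide one of the monomials. -/
theorem exists_ne_zero_iff (h : IsRelationLabelling T u x) (hT : T.Connected) {y : σ} :
    (∃ a, u a y ≠ 0) ↔ ∃ a b, T.Adj a b ∧ x a b = y := by
  constructor
  · rintro ⟨r, hr⟩
    obtain ⟨p, d, hp⟩ := hT.exists_isParentMap r
    by_contra! hne
    exact hr (h.apply_eq_zero hp fun a ha => hne a (p a) (hp.adj a ha))
  · rintro ⟨a, b, hab, rfl⟩
    exact ⟨b, by rw [h.apply_label hab]; omega⟩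

/-- Two monomials with a relation of linear forms `y u_i = z u_j` belong to adjacent vertices: a
path with at least two edges from `j` to `i` would contribute at least three variables whose
exponents in `u i` and `u j` differ. -/
theorem adj_of_add_single_eq (h : IsRelationLabelling T u x) (hT : T.Connected) {i j : V}
    (hij : i ≠ j) {y z : σ} (hyz : u i + Finsupp.single y 1 = u j + Finsupp.single z 1) :
    T.Adj i j := by
  classical
  obtain ⟨p, d, hp⟩ := hT.exists_isParentMap i
  have hdiff : ∀ w, u i w ≠ u j w → w = y ∨ w = z := by
    intro w hw
    by_contra! hne
    have := DFunLike.congr_fun hyz w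
    simp [hne.1, hne.2] at this
    exact hw this
  have hj := hp.adj j hij.symm
  by_cases hk : p j = i
  · exact (hk ▸ hj).symm
  exfalso
  have hk' := hp.adj (p j) hk
  have hlj : p (p j) ≠ j := hp.ne_of_eq hij.symm hk rfl
  set k := p j with hkdef
  set l := p k with hldef
  have hjk : x j k ≠ x k j := (h.label_ne hj).symm
  have hkl1 : x k l ≠ x j k := fun e => hj.ne (h.inj _ _ _ _ hk' hj e).1.symm
  have hkl2 : x k l ≠ x k j := fun e => hlj (h.inj _ _ _ _ hk' hj.symm e).2
  have e1 : u i (x j k) = 1 := h.apply_label_parent hp hij.symm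
  have e2 : u j (x j k) = 0 := by
    have := h.apply_label hj
    have := h.apply_le_one hT k (x j k)
    omega
  have e3 : u i (x k j) = 0 := by
    refine h.apply_eq_zero hp fun a ha e => ?_
    have := h.inj _ _ _ _ (hp.adj a ha) hj.symm e
    exact hlj (by rw [hldef, ← this.1, this.2])
  have e4 : u j (x k j) = u k (x k j) + 1 := h.apply_label hj.symm
  have e5 : u i (x k l) = 1 := h.apply_label_parent hp hk
  have e6 : u k (x k l) = 0 := by
    have := h.apply_label hk'
    have := h.apply_le_one hT l (x k l)
    omega
  have e7 : u j (x k l) = u k (x k l) := h.apply_eq hj hkl1.symm hkl2.symm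
  have d1 := hdiff (x j k) (by omega)
  have d2 := hdiff (x k j) (by omega)
  have d3 := hdiff (x k l) (by omega)
  grind

end IsRelationLabelling

/-! ### Maximal minors of the generic matrix -/

section GenericMatrix

variable (K : Type*) [Field K] {m : ℕ} {T : SimpleGraph (Fin m)}

theorem genericMatrix_eq_zero {e : T.edgeSet} {l : Fin m} (hl : l ∉ e.1) :
    genericMatrix K T e l = 0 := by
  refine Finset.sum_eq_zero fun j _ => dif_neg fun h => hl ?_
  rw [h]
  exact Sym2.mem_mk_left l j

theorem genericMatrix_associated {a b : Fin m} (hab : T.Adj a b) :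
    Associated (genericMatrix K T ⟨s(a, b), hab⟩ a) (X ⟨(a, b), hab⟩) := by
  have h : genericMatrix K T ⟨s(a, b), hab⟩ a =
      if a < b then X ⟨(a, b), hab⟩ else -X ⟨(a, b), hab⟩ := by
    unfold genericMatrix
    rw [Finset.sum_eq_single b]
    · simp
    · intro j _ hj
      refine dif_neg fun h => hj ?_
      rcases Sym2.eq_iff.1 h with h' | h'
      · exact h'.2.symm
      · exact h'.2.trans h'.1 |>.symm ▸ absurd h'.2 hab.ne'
    · simp
  rw [h]
  split_ifs
  · exact Associated.refl _
  · exact (Associated.refl _).neg_left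

variable {K} {r : Fin m} {p : Fin m → Fin m} {d : Fin m → ℕ}

/-- With the rows indexed by the lower ends of the edges, the generic matrix without the column of
the root is triangular with respect to the level, with the variables `x_{a, p a}` on the
diagonal. -/
theorem IsParentMap.det_associated (hp : IsParentMap T r p d) :
    Associated ((genericMatrix K T).submatrix hp.edge Subtype.val).det
      (∏ a : {a // a ≠ r}, X ⟨(a.1, p a.1), hp.adj a.1 a.2⟩) := by
  classical
  set N := (genericMatrix K T).submatrix hp.edge Subtype.val with hN
  have hoff : ∀ a b : {a // a ≠ r}, b ≠ a → b.1 ≠ p a.1 → N a b = 0 := by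
    intro a b h1 h2
    refine genericMatrix_eq_zero K fun h => ?_
    rcases Sym2.mem_iff.1 h with h | h
    · exact h1 (Subtype.ext h)
    · exact h2 h
  have hdet : N.det = ∏ a, N a a := by
    rw [Matrix.det_apply, Finset.sum_eq_single 1]
    · simp
    · intro σ _ hσ
      -- In a non-zero term each `σ a ≠ a` is a child of `a`, so that `σ ≠ 1` would increase the
      -- sum of the levels, which is invariant under permutations.
      by_contra hne
      have hprod : ∀ a, N (σ a) a ≠ 0 := by
        intro a ha
        exact hne (by
          rw [Finset.prod_eq_zero (f := fun i => N (σ i) i) (Finset.mem_univ a) ha, smul_zero])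
      have hle : ∀ a, d a.1 ≤ d (σ a).1 ∧ (σ a ≠ a → d a.1 < d (σ a).1) := by
        intro a
        by_cases h : σ a = a
        · exact ⟨by rw [h], fun h' => absurd h h'⟩
        · have h1 : a.1 = p (σ a).1 := by
            by_contra h2
            exact hprod a (hoff _ _ (Ne.symm h) h2)
          have h2 := hp.lt _ (σ a).2
          rw [← h1] at h2
          exact ⟨h2.le, fun _ => h2⟩
      obtain ⟨a, ha⟩ : ∃ a, σ a ≠ a := by
        by_contra! h
        exact hσ (Equiv.ext h)
      have hlt : ∑ a : {a // a ≠ r}, d a.1 < ∑ a, d (σ a).1 :=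
        Finset.sum_lt_sum (fun a _ => (hle a).1) ⟨a, Finset.mem_univ a, (hle a).2 ha⟩
      rw [Equiv.sum_comp σ fun a : {a // a ≠ r} => d a.1] at hlt
      exact hlt.ne rfl
    · simp
  rw [hdet]
  exact Associated.prod _ _ _ fun a _ => genericMatrix_associated K (hp.adj a.1 a.2)

theorem Matrix.det_submatrix_associated {R ρ κ ι : Type*} [CommRing R] [Fintype ρ] [DecidableEq ρ]
    [Fintype κ] [DecidableEq κ] (A : Matrix ρ ι R) (e : κ ≃ ρ) (f : ρ → ι) (g : κ → ι)
    (τ : Equiv.Perm κ) (hf : ∀ a, f (e a) = g (τ a)) :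
    Associated (A.submatrix id f).det (A.submatrix e g).det := by
  have h : (A.submatrix id f).submatrix e e = (A.submatrix e g).submatrix id τ := by
    ext a b
    simp [hf]
  rw [← Matrix.det_submatrix_equiv_self e, h, Matrix.det_permute']
  rcases Int.units_eq_one_or (Equiv.Perm.sign τ) with h | h <;> simp [h]

open Classical in
/-- Up to sign, the maximal minors of the generic matrix which omit the column `r` are the product
of the variables `x_{a, p a}` for the parents `p a` with respect to the root `r`. -/
theorem IsParentMap.minor_associated (hp : IsParentMap T r p d) (hT : T.IsTree)
    (f : T.edgeSet ↪ Fin m) (hf : r ∉ Set.range f) :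
    Associated ((genericMatrix K T).submatrix id f).det
      (∏ a : {a // a ≠ r}, X ⟨(a.1, p a.1), hp.adj a.1 a.2⟩) := by
  let e := Equiv.ofBijective hp.edge (hp.edge_bijective hT)
  have hinj : Function.Injective
      (fun a => (⟨f (e a), fun h => hf ⟨_, h⟩⟩ : {a // a ≠ r})) := by
    intro a b hab
    exact e.injective (f.injective (congrArg Subtype.val hab))
  exact (Matrix.det_submatrix_associated _ e f Subtype.val
    (Equiv.ofBijective _ (Finite.injective_iff_bijective.1 hinj)) fun a => rfl).trans
    hp.det_associated

theorem SimpleGraph.IsTree.exists_notMem_range (hT : T.IsTree) (f : T.edgeSet ↪ Fin m) :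
    ∃ r, r ∉ Set.range f := by
  classical
  by_contra! h
  have h1 := hT.card_edgeFinset
  rw [SimpleGraph.edgeFinset_card] at h1
  have h2 := Fintype.card_le_of_surjective f h
  omega

theorem SimpleGraph.IsTree.exists_embedding_notMem_range (hT : T.IsTree) (r : Fin m) :
    ∃ f : T.edgeSet ↪ Fin m, r ∉ Set.range f := by
  obtain ⟨p, d, hp⟩ := hT.connected.exists_isParentMap r
  let e := Equiv.ofBijective hp.edge (hp.edge_bijective hT)
  refine ⟨e.symm.toEmbedding.trans (Function.Embedding.subtype _), ?_⟩
  rintro ⟨a, ha⟩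
  exact (e.symm a).2 ha

end GenericMatrix

theorem Ideal.span_range_eq_of_associated {R α β : Type*} [CommRing R] {f : α → R} {g : β → R}
    (hfg : ∀ a, ∃ b, Associated (f a) (g b)) (hgf : ∀ b, ∃ a, Associated (f a) (g b)) :
    Ideal.span (Set.range f) = Ideal.span (Set.range g) := by
  apply le_antisymm <;> rw [Ideal.span_le] <;> rintro _ ⟨a, rfl⟩
  · obtain ⟨b, hb⟩ := hfg a
    exact Ideal.mem_of_dvd _ hb.dvd' (Ideal.subset_span ⟨b, rfl⟩)
  · obtain ⟨b, hb⟩ := hgf a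
    exact Ideal.mem_of_dvd _ hb.dvd (Ideal.subset_span ⟨b, rfl⟩)

/-- If `x` is a relation labelling of the tree `T`, renaming the variables of the generic ideal by
`x` gives the ideal generated by the monomials attached to the vertices. -/
theorem IsRelationLabelling.map_genericIdeal (K : Type*) [Field K] {σ : Type*} {m : ℕ}
    {T : SimpleGraph (Fin m)} {u : Fin m → σ →₀ ℕ} {x : Fin m → Fin m → σ}
    (h : IsRelationLabelling T u x) (hT : T.IsTree) :
    (genericIdeal K T).map (rename (R := K) fun t : T.Dart => x t.fst t.snd) =
      Ideal.span (Set.range fun i => monomial (u i) (1 : K)) := by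
  classical
  have key : ∀ (r : Fin m) (f : T.edgeSet ↪ Fin m), r ∉ Set.range f →
      Associated (rename (R := K) (fun t : T.Dart => x t.fst t.snd)
        ((genericMatrix K T).submatrix id f).det) (monomial (u r) (1 : K)) := by
    intro r f hf
    obtain ⟨p, d, hp⟩ := hT.connected.exists_isParentMap r
    have := (hp.minor_associated (K := K) hT f hf).map
      (rename (R := K) fun t : T.Dart => x t.fst t.snd)
    convert this using 1
    rw [h.eq_sum hp, map_prod, monomial_sum_one]
    exact Finset.prod_congr rfl fun a _ => by rw [rename_X, X]
  unfold genericIdeal maximalMinorsIdeal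
  rw [Ideal.map_span, ← Set.range_comp]
  refine Ideal.span_range_eq_of_associated (fun f => ?_) fun r => ?_
  · obtain ⟨r, hr⟩ := hT.exists_notMem_range f
    refine ⟨r, ?_⟩
    convert key r f hr using 1
    simp only [Function.comp_apply]
    congr!
  · obtain ⟨f, hf⟩ := hT.exists_embedding_notMem_range r
    refine ⟨f, ?_⟩
    convert key r f hf using 1
    simp only [Function.comp_apply]
    congr!

/-! ### Relation matrices -/

/-- If some variable divides all the monomials, the ideal is contained in a principal ideal and has
height at most one. -/
theorem exists_apply_eq_zero_of_one_lt_height {K σ ι : Type*} [Field K] [Finite σ]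
    (u : ι → σ →₀ ℕ)
    (h : 1 < (Ideal.span (Set.range fun i => monomial (u i) (1 : K))).height) (y : σ) :
    ∃ i, u i y = 0 := by
  by_contra! hne
  have hle : Ideal.span (Set.range fun i => monomial (u i) (1 : K)) ≤ Ideal.span {X y} := by
    rw [Ideal.span_le]
    rintro _ ⟨i, rfl⟩
    rw [SetLike.mem_coe, Ideal.mem_span_singleton, X_dvd_monomial]
    exact Or.inr (hne i)
  have hprime : (Ideal.span {(X y : MvPolynomial σ K)}).IsPrime :=
    (Ideal.span_singleton_prime (X_ne_zero y)).2 (X_prime)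
  have h1 : (Ideal.span {(X y : MvPolynomial σ K)}).height ≤ 1 :=
    Ideal.height_le_one_of_isPrincipal_of_mem_minimalPrimes (Ideal.span {X y}) _
      (by rw [Ideal.minimalPrimes_eq_subsingleton_self]; rfl)
  exact absurd (h.trans_le ((Ideal.height_mono hle).trans h1)) (lt_irrefl _)

namespace IsRelationMatrix

variable {K : Type*} [Field K] {n m : ℕ} {u : Fin m → (Fin n →₀ ℕ)}
  {A : Matrix (Fin (m - 1)) (Fin m) (MvPolynomial (Fin n) K)}

theorem sum_row_eq_zero (hA : IsRelationMatrix u A) (r : Fin (m - 1)) :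
    ∑ c, A r c * monomial (u c) (1 : K) = 0 := by
  have := (hA.exact (A r)).2 ⟨Pi.single r 1, by simp; rfl⟩
  simpa [Fintype.linearCombination_apply] using this

/-- The shape of a row with non-zero entries in two different columns `i` and `j`. -/
theorem row_eq (hA : IsRelationMatrix u A) {r : Fin (m - 1)} {i j : Fin m} (hij : i ≠ j)
    (hi : A r i ≠ 0) (hj : A r j ≠ 0) : ∃ k l : Fin n,
      (A r = Pi.single i (X k) - Pi.single j (X l) ∨
        A r = -(Pi.single i (X k) - Pi.single j (X l))) ∧
      u i + Finsupp.single k 1 = u j + Finsupp.single l 1 := by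
  obtain ⟨a, b, k, l, hab, hr⟩ := hA.binomial r
  have hsupp : ∀ c, A r c ≠ 0 → c = a ∨ c = b := by
    intro c hc
    by_contra! h
    exact hc (by simp [hr, h.1, h.2])
  have hrel : u a + Finsupp.single k 1 = u b + Finsupp.single l 1 := by
    have h := hA.sum_row_eq_zero r
    simp only [hr, Pi.sub_apply, sub_mul, Finset.sum_sub_distrib, Pi.single_apply, ite_mul,
      zero_mul, Finset.sum_ite_eq', Finset.mem_univ, if_true] at h
    rw [sub_eq_zero, X, X, monomial_mul, monomial_mul, one_mul] at h
    have := monomial_left_injective (one_ne_zero (α := K)) h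
    rwa [add_comm (u a), add_comm (u b)]
  rcases hsupp i hi with rfl | rfl <;> rcases hsupp j hj with rfl | rfl
  · exact absurd rfl hij
  · exact ⟨k, l, Or.inl hr, hrel⟩
  · exact ⟨l, k, Or.inr (by rw [hr, neg_sub]), hrel.symm⟩
  · exact absurd rfl hij

theorem support_row (hA : IsRelationMatrix u A) {r : Fin (m - 1)} {i j c : Fin m} (hij : i ≠ j)
    (hi : A r i ≠ 0) (hj : A r j ≠ 0) (hc : A r c ≠ 0) : c = i ∨ c = j := by
  obtain ⟨k, l, h, -⟩ := hA.row_eq hij hi hj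
  by_contra! hne
  rcases h with h | h <;> exact hc (by simp [h, hne.1, hne.2])

theorem exists_support_row (hA : IsRelationMatrix u A) (r : Fin (m - 1)) :
    ∃ i j, i ≠ j ∧ A r i ≠ 0 ∧ A r j ≠ 0 := by
  obtain ⟨i, j, k, l, hij, hr⟩ := hA.binomial r
  exact ⟨i, j, hij, by simp [hr, hij], by simp [hr, hij.symm]⟩

/-- If `i` and `j` were in different components of the relation graph, the part of the relation
`u_j e_i - u_i e_j` in the component of `i` would be a relation too. -/
theorem connected (hA : IsRelationMatrix u A) [Nonempty (Fin m)] :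
    (relationGraph A).Connected := by
  classical
  refine ⟨fun i j => ?_⟩
  by_contra hij
  let C : Fin m → Prop := fun a => (relationGraph A).Reachable i a
  let L := Fintype.linearCombination (MvPolynomial (Fin n) K)
    fun a => if C a then monomial (u a) (1 : K) else 0
  have hL : ∀ r, L (A r) = 0 := by
    intro r
    obtain ⟨a, b, hab, ha, hb⟩ := hA.exists_support_row r
    have hadj : (relationGraph A).Adj a b := ⟨hab, r, ha, hb⟩
    have hC : C a ↔ C b :=
      ⟨fun h => h.trans hadj.reachable, fun h => h.trans hadj.symm.reachable⟩
    by_cases h : C a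
    · rw [← hA.sum_row_eq_zero r, Fintype.linearCombination_apply]
      refine Finset.sum_congr rfl fun c _ => ?_
      by_cases hc : A r c = 0
      · simp [hc]
      · rcases hA.support_row hab ha hb hc with rfl | rfl
        · simp [h]
        · simp [hC.1 h]
    · rw [Fintype.linearCombination_apply]
      refine Finset.sum_eq_zero fun c _ => ?_
      by_cases hc : A r c = 0
      · simp [hc]
      · rcases hA.support_row hab ha hb hc with rfl | rfl
        · simp [h]
        · simp [mt hC.2 h]
  let s : Fin m → MvPolynomial (Fin n) K :=
    Pi.single i (monomial (u j) 1) - Pi.single j (monomial (u i) 1)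
  obtain ⟨c, hc⟩ := (hA.exact s).1 (by
    rw [map_sub, Fintype.linearCombination_apply_single, Fintype.linearCombination_apply_single]
    simp [monomial_mul, add_comm])
  have h1 : L s = 0 := by
    rw [← hc, Matrix.vecMulLinear_apply, Matrix.vecMul_eq_sum, map_sum]
    exact Finset.sum_eq_zero fun r _ => by rw [map_smul, hL, smul_zero]
  have h2 : L s = monomial (u j + u i) 1 := by
    have hi : C i := SimpleGraph.Reachable.refl i
    have hj : ¬ C j := hij
    rw [map_sub, Fintype.linearCombination_apply_single, Fintype.linearCombination_apply_single,
      if_pos hi, if_neg hj]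
    simp [monomial_mul]
  rw [h1] at h2
  exact one_ne_zero (monomial_eq_zero.1 h2.symm)

/-- The relation graph has at most `m - 1` edges, as different edges come from different rows. -/
theorem isTree (hA : IsRelationMatrix u A) [Nonempty (Fin m)] : (relationGraph A).IsTree := by
  have hconn := hA.connected
  rw [SimpleGraph.isTree_iff_connected_and_card]
  refine ⟨hconn, le_antisymm ?_ hconn.card_vert_le_card_edgeSet_add_one⟩
  have hrow : ∀ e : (relationGraph A).edgeSet, ∃ r, ∀ c, A r c ≠ 0 ↔ c ∈ e.1 := by
    rintro ⟨e, he⟩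
    induction e with
    | _ i j =>
      obtain ⟨hij, r, hi, hj⟩ : (relationGraph A).Adj i j := he
      refine ⟨r, fun c => ⟨fun hc => Sym2.mem_iff.2 (hA.support_row hij hi hj hc), fun hc => ?_⟩⟩
      rcases Sym2.mem_iff.1 hc with rfl | rfl
      · exact hi
      · exact hj
  choose row hrow using hrow
  have hinj : Function.Injective row := fun e e' h =>
    Subtype.ext (Sym2.ext fun c => by rw [← hrow, ← hrow, h])
  have h1 := Nat.card_le_card_of_injective row hinj
  have h2 : 0 < m := Fin.pos_iff_nonempty.2 inferInstance
  simp only [Nat.card_eq_fintype_card (α := Fin _), Fintype.card_fin] at h1 ⊢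
  omega

/-- Attaching to an edge `{i, j}` and its end `i` the variable in column `i` of a row belonging to
this edge is a relation labelling. -/
theorem exists_isRelationLabelling (hA : IsRelationMatrix u A)
    (hu : ∀ i j, i ≠ j → ¬ u i ≤ u j) (hdist : HasDistinctVariables A)
    (hzero : ∀ y, ∃ i, u i y = 0) (v : Fin n) :
    ∃ x, IsRelationLabelling (relationGraph A) u x := by
  classical
  have h : ∀ i j, ∃ k, (relationGraph A).Adj i j → ∃ r l, A r i ≠ 0 ∧ A r j ≠ 0 ∧
      (A r i).vars = {k} ∧ u i + Finsupp.single k 1 = u j + Finsupp.single l 1 := by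
    intro i j
    by_cases hadj : (relationGraph A).Adj i j
    · obtain ⟨hij, r, hi, hj⟩ := hadj
      obtain ⟨k, l, hr, hrel⟩ := hA.row_eq hij hi hj
      refine ⟨k, fun _ => ⟨r, l, hi, hj, ?_, hrel⟩⟩
      rcases hr with hr | hr <;> simp [hr, hij, vars_neg, vars_X]
    · exact ⟨v, fun h => absurd h hadj⟩
  choose x hx using h
  refine ⟨x, ⟨fun i j hij => ?_, fun i j i' j' hij hij' hxx => ?_, hzero⟩⟩
  · obtain ⟨-, l, -, -, -, h1⟩ := hx i j hij
    obtain ⟨-, l', -, -, -, h2⟩ := hx j i hij.symm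
    -- The second variable of the relation is determined by `u i` and `u j`, so that both choices
    -- of a row give the same relation.
    suffices hl : l = x j i by rwa [hl] at h1
    have hne : x i j ≠ l := fun e => by
      rw [e] at h1
      exact hu i j hij.ne (add_right_cancel h1).le
    have e1 := DFunLike.congr_fun h1 l
    have e2 := DFunLike.congr_fun h2 l
    simp only [Finsupp.add_apply, Finsupp.single_apply, if_neg hne, if_true] at e1 e2
    by_contra hl
    rw [if_neg (Ne.symm hl)] at e2
    omega
  · obtain ⟨r, -, hi, hj, hv, -⟩ := hx i j hij
    obtain ⟨r', -, hi', hj', hv', -⟩ := hx i' j' hij'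
    have hrr : (r, i) = (r', i') := by
      by_contra hne
      have := hdist r i r' i' hne
      rw [hv, hv', hxx] at this
      simp at this
    obtain ⟨rfl, rfl⟩ := Prod.mk.inj hrr
    refine ⟨rfl, ?_⟩
    exact ((hA.support_row hij.ne hi hj hj').resolve_left hij'.ne').symm

end IsRelationMatrix

/-! ### Renaming the variables and uniqueness of the relation tree -/

theorem IsRelationLabelling.isIsomorphicByRenaming {K : Type*} [Field K] {n m : ℕ}
    {T : SimpleGraph (Fin m)} {u : Fin m → (Fin n →₀ ℕ)} {x : Fin m → Fin m → Fin n}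
    (h : IsRelationLabelling T u x) (hT : T.IsTree) :
    IsIsomorphicByRenaming (Ideal.span (Set.range fun i => monomial (u i) (1 : K))) u
      (genericIdeal K T) := by
  let f : T.Dart → {v : Fin n // ∃ i, u i v ≠ 0} := fun t =>
    ⟨x t.fst t.snd, (h.exists_ne_zero_iff hT.connected).2 ⟨t.fst, t.snd, t.adj, rfl⟩⟩
  have hf : Function.Bijective f := by
    constructor
    · intro s t hst
      have := h.inj _ _ _ _ s.adj t.adj (congrArg Subtype.val hst)
      exact SimpleGraph.Dart.ext _ _ (Prod.ext this.1 this.2)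
    · rintro ⟨y, hy⟩
      obtain ⟨a, b, hab, rfl⟩ := (h.exists_ne_zero_iff hT.connected).1 hy
      exact ⟨⟨(a, b), hab⟩, rfl⟩
  exact ⟨Equiv.ofBijective f hf, h.map_genericIdeal K hT⟩

theorem proposition3p3 {K : Type*} [Field K] {n m : ℕ} (J : Ideal (MvPolynomial (Fin n) K))
    (hcodim : J.height = 2)
    (hCM : IsCohenMacaulayRing (MvPolynomial (Fin n) K ⧸ J))
    (hlin : HasLinearResolution J)
    (u : Fin m → (Fin n →₀ ℕ)) (hu : IsMinimalMonomialGenerators J u)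
    (A : Matrix (Fin (m - 1)) (Fin m) (MvPolynomial (Fin n) K))
    (hA : IsRelationMatrix u A) (hdist : HasDistinctVariables A) :
    (relationGraph A).IsTree ∧
    IsIsomorphicByRenaming J u (genericIdeal K (relationGraph A)) ∧
    ∀ A' : Matrix (Fin (m - 1)) (Fin m) (MvPolynomial (Fin n) K),
      IsRelationMatrix u A' → relationGraph A' = relationGraph A := by
  obtain rfl := hu.span_eq
  have hm : Nonempty (Fin m) := by
    by_contra hm
    rw [not_nonempty_iff] at hm
    rw [Set.range_eq_empty, Ideal.span_empty, Ideal.height_bot] at hcodim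
    exact absurd hcodim (by norm_num)
  have hn : Nonempty (Fin n) := by
    by_contra hn
    rw [not_nonempty_iff] at hn
    have htop : Ideal.span (Set.range fun i => monomial (u i) (1 : K)) = ⊤ := by
      rw [Ideal.eq_top_iff_one]
      refine Ideal.subset_span ⟨hm.some, ?_⟩
      simp [Subsingleton.elim (u hm.some) 0]
    rw [htop, Ideal.height_top] at hcodim
    exact absurd hcodim (by simp)
  have hzero := exists_apply_eq_zero_of_one_lt_height (K := K) u (by rw [hcodim]; norm_num)
  have hT := hA.isTree
  obtain ⟨x, hx⟩ := hA.exists_isRelationLabelling hu.not_le hdist hzero hn.some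
  refine ⟨hT, hx.isIsomorphicByRenaming hT, fun A' hA' => ?_⟩
  have hle : relationGraph A' ≤ relationGraph A := by
    rintro i j ⟨hij, r, hi, hj⟩
    obtain ⟨k, l, -, hrel⟩ := hA'.row_eq hij hi hj
    exact hx.adj_of_add_single_eq hT.connected hij hrel
  exact le_antisymm hle
    ((SimpleGraph.isTree_iff_minimal_connected.1 hT).2 hA'.connected hle)
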